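/- **Theorem (uniform upper bound for $\sigma_k$ when $p$ is odd).** *Setting.* Let $n\ge 1$, let $p\ge 3$ be odd and $p'=p+1$. Let $f:\mathbb R^n\to\mathbb R$ be bounded below and $p$ times continuously differentiable, and let $L>0$ satisfy $\|\nabla^p f(x)-\nabla^p f(y)\|\le (p-1)!\,L\,\|x-y\|$ for all $x,y\in\mathbb R^n$; here $\|\cdot\|$ is the Euclidean norm for vectors and $\|T\|=\max_{\|v_1\|=\dots=\|v_j\|=1}|T[v_1,\dots,v_j]|$ for $j$th-order tensors. Let $0<\epsilon<1$, $a\in[0,\tfrac12]$, $\delta=\epsilon^a$, $\sigma_{\min}>0$, $0<\eta<1$, $\gamma_1>1>\gamma_2>0$. A polynomial is *SoS-convex* if its Hessian $H(s)$ is $V(s)^{T}V(s)$ for some (not necessarily square) polynomial matrix $V$. *Algorithm.* Start with $x_0=0$ and $\sigma_0^r=\sigma_{\min}$. In iteration $k=0,1,2,\dots$: 1. If $\|\nabla f(x_k)\|\le\epsilon$, terminate. 2. Let $\lambda_k$ be the smallest eigenvalue of $\nabla^2 f(x_k)$, and let $c_k=0$ if $\lambda_k\ge\delta$, $c_k=-\lambda_k+\delta$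 if $\lambda_k\le0$, and $c_k=\delta$ if $0<\lambda_k\le\delta$ (if $\lambda_k=\delta$, either value may be used). For $\sigma\in\mathbb R$ put $$m_{k,\sigma}(s)=T_p(x_k,s)+\frac{c_k}{2}\|s\|^2+\frac{\sigma}{p'}\|s\|^{p'},\qquad T_p(x,s)=f(x)+\sum_{j=1}^p\frac1{j!}\nabla^j f(x)[s]^j .$$ Let $\bar\sigma_k$ be the smallest $\sigma$ for which $m_{k,\sigma}$ is SoS-convex, put $\sigma_k=\max\{\bar\sigma_k,\sigma_k^r\}$, and let $s_k$ be a global minimizer of $m_{k,\sigma_k}$ over $\mathbb R^n$. 3. Put $\rho_k=\dfrac{f(x_k)-f(x_k+s_k)}{f(x_k)-T_p(x_k,s_k)}$. If $\rho_k>\eta$, set $x_{k+1}=x_k+s_k$ and $\sigma_{k+1}^r=\max\{\gamma_2\sigma_k,\sigma_{\min}\}$; otherwise set $x_{k+1}=x_k$ and $\sigma_{k+1}^r=\gamma_1\sigma_k$. Suppose that the constants $\Lambda_1,\dots,\Lambda_p$ satisfy $\|\nabla^j f(x_k)\|\le\Lambda_j$ for all $j=1,\dots,p$ and all $k$ for which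 iteration $k$ is performed (that is, the method does not terminate at or before it). *Constants.* There is an $R>0$, depending only on $n$ and $p$, with the property that $\|s\|^2+\|s\|^{p'}+q(s)$ is SoS-convex for every real polynomial $q$ on $\mathbb R^n$ of degree at most $p$ whose coefficients in the monomial basis are all at most $R$ in absolute value. Fix any such $R$ and put $$A_0=\frac{L\,p'}{(p+1)(1-\eta)},\qquad C_R=\frac{p'}{2}\Big(\sum_{j=3}^p\frac{2\Lambda_j}{R}\Big)^{p'-2},\qquad \hat C_R=\max\Big\{\sigma_0,\ \gamma_1A_0,\ p'\frac{\delta}{2},\ C_R\Big\},$$ where $\sigma_0$ may be read either as the initial parameter $\sigma_0^r=\sigma_{\min}$ or as the parameter $\max\{\bar\sigma_0,\sigma_0^r\}$ of iteration $0$. *Conclusion.* For every $k$ such that iteration $k$ is performed, $$\sigma_k\le\max\Big\{\sigma_0,\ \gamma_1A_0,\ p'\frac{\delta}{2},\ C_R\,\delta^{3-p'}\Big\} \qquad\text{and}\qquad \sigma_k\le\hat C_R\,\epsilon^{a(2-p)}=:\sigma_{\max}.$$ -/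

import Mathlib

open scoped Nat

/-- Euclidean space `ℝⁿ`. -/
abbrev RSpace (n : ℕ) : Type := EuclideanSpace ℝ (Fin n)

/-- The Hessian of a polynomial, as a matrix of polynomials. -/
noncomputable def polyHessian {n : ℕ} (q : MvPolynomial (Fin n) ℝ) :
    Matrix (Fin n) (Fin n) (MvPolynomial (Fin n) ℝ) :=
  Matrix.of fun i j => MvPolynomial.pderiv i (MvPolynomial.pderiv j q)

/-- An SoS-matrix: a polynomial matrix of the form `Vᵀ V`, with `V` a polynomial matrix having
any finite number of rows. -/
def IsSosMatrix {n : ℕ} (H : Matrix (Fin n) (Fin n) (MvPolynomial (Fin n) ℝ)) : Prop :=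
  ∃ (r : ℕ) (V : Matrix (Fin r) (Fin n) (MvPolynomial (Fin n) ℝ)), H = V.transpose * V

/-- A function `g : ℝⁿ → ℝ` is an SoS-convex polynomial: it is a polynomial function, and the
Hessian of the (unique) polynomial representing it is an SoS-matrix. -/
def IsSosConvex {n : ℕ} (g : RSpace n → ℝ) : Prop :=
  ∃ q : MvPolynomial (Fin n) ℝ,
    (∀ s : RSpace n, g s = MvPolynomial.eval (fun i => s i) q) ∧ IsSosMatrix (polyHessian q)

/-- The regularization power `p'`: `p + 1` for odd `p`, `p + 2` for even `p`. -/
def regPower (p : ℕ) : ℕ := if p % 2 = 1 then p + 1 else p + 2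

/-- `R > 0` is such that `‖s‖² + ‖s‖^p' + q(s)` is SoS-convex for every polynomial `q` of degree
at most `p` all of whose coefficients (in the monomial basis) are at most `R` in absolute value. -/
def IsSosRadius (n p : ℕ) (R : ℝ) : Prop :=
  0 < R ∧ ∀ q : MvPolynomial (Fin n) ℝ, q.totalDegree ≤ p → (∀ m, |q.coeff m| ≤ R) →
    IsSosConvex fun s : RSpace n =>
      ‖s‖ ^ 2 + ‖s‖ ^ regPower p + MvPolynomial.eval (fun i => s i) q

/-- The class `C^{p,1}(ℝⁿ)`, with Lipschitz constant `(p-1)! L` for the `p`-th derivative. The norm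
of a tensor is the operator norm `max |T[v₁, …, v_p]|` over unit vectors `v₁, …, v_p`. -/
structure IsCp1 {n : ℕ} (p : ℕ) (L : ℝ) (f : RSpace n → ℝ) : Prop where
  contDiff : ContDiff ℝ p f
  bddBelow : BddBelow (Set.range f)
  lipschitz : ∀ x y : RSpace n,
    ‖iteratedFDeriv ℝ p f x - iteratedFDeriv ℝ p f y‖ ≤ ((p - 1)! : ℝ) * L * ‖x - y‖

/-- The `p`-th order Taylor polynomial `T_p(x, s)` of `f` at `x`, as a function of the step `s`. -/
noncomputable def taylorModel {n : ℕ} (f : RSpace n → ℝ) (p : ℕ) (x s : RSpace n) : ℝ :=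
  f x + ∑ j ∈ Finset.Icc 1 p, 1 / (j ! : ℝ) * iteratedFDeriv ℝ j f x (fun _ => s)

/-- The Hessian matrix of `f` at `x`. -/
noncomputable def hessianMatrix {n : ℕ} (f : RSpace n → ℝ) (x : RSpace n) :
    Matrix (Fin n) (Fin n) ℝ :=
  Matrix.of fun i j =>
    iteratedFDeriv ℝ 2 f x ![EuclideanSpace.single i 1, EuclideanSpace.single j 1]

/-- The smallest eigenvalue of the Hessian matrix of `f` at `x`. -/
noncomputable def lambdaMin {n : ℕ} (f : RSpace n → ℝ) (x : RSpace n) : ℝ :=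
  sInf (spectrum ℝ (hessianMatrix f x))

/-- `c` is the coefficient of the quadratic perturbation `(c / 2) ‖s‖²` of the SoS Taylor model,
where `lam` is the smallest eigenvalue of the Hessian: the locally strongly convex, the locally
nonconvex and the locally nearly strongly convex case. If `lam = δ`, then the first and the third
case both apply, and either perturbation is allowed. -/
def IsPerturbation (δ lam c : ℝ) : Prop :=
  (δ ≤ lam ∧ c = 0) ∨ (lam ≤ 0 ∧ c = -lam + δ) ∨ (0 < lam ∧ lam ≤ δ ∧ c = δ)

/-- The SoS Taylor model `m_c(x, s)` with quadratic perturbation `c` and regularization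
parameter `σ`. -/
noncomputable def sosModel {n : ℕ} (f : RSpace n → ℝ) (p : ℕ) (c σ : ℝ) (x s : RSpace n) : ℝ :=
  taylorModel f p x s + c / 2 * ‖s‖ ^ 2 + σ / (regPower p : ℝ) * ‖s‖ ^ regPower p

/-- The optimal value `σ̄` of the program: minimize `σ` subject to `m_c(x, ·)` being SoS-convex. -/
noncomputable def sigmaBar {n : ℕ} (f : RSpace n → ℝ) (p : ℕ) (c : ℝ) (x : RSpace n) : ℝ :=
  sInf {σ : ℝ | IsSosConvex (sosModel f p c σ x)}

/-- The ratio `ρ` of actual to predicted decrease. -/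
noncomputable def decreaseRatio {n : ℕ} (f : RSpace n → ℝ) (p : ℕ) (x s : RSpace n) : ℝ :=
  (f x - f (x + s)) / (f x - taylorModel f p x s)

/-- Iteration `k` passes the termination test, as do all earlier ones, so that the method goes on
to compute `σ_k` and `s_k`. -/
def IsPerformed {n : ℕ} (f : RSpace n → ℝ) (ε : ℝ) (x : ℕ → RSpace n) (k : ℕ) : Prop :=
  ∀ j ≤ k, ε < ‖gradient f (x j)‖

/-- `x_k`, `s_k`, `c_k`, `σ^r_k`, `σ_k` are produced by the adaptive `p`-th order regularization
method with SoS Taylor models; the sequences are unconstrained after termination. -/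
structure IsArpSosRun {n : ℕ} (f : RSpace n → ℝ) (p : ℕ) (ε δ η γ₁ γ₂ σmin : ℝ)
    (x s : ℕ → RSpace n) (c σr σ : ℕ → ℝ) : Prop where
  x_zero : x 0 = 0
  σr_zero : σr 0 = σmin
  perturbation : ∀ k, IsPerformed f ε x k → IsPerturbation δ (lambdaMin f (x k)) (c k)
  σ_eq : ∀ k, IsPerformed f ε x k → σ k = max (sigmaBar f p (c k) (x k)) (σr k)
  step : ∀ k, IsPerformed f ε x k → ∀ t, sosModel f p (c k) (σ k) (x k) (s k) ≤
    sosModel f p (c k) (σ k) (x k) t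
  success : ∀ k, IsPerformed f ε x k → η < decreaseRatio f p (x k) (s k) →
    x (k + 1) = x k + s k ∧ σr (k + 1) = max (γ₂ * σ k) σmin
  failure : ∀ k, IsPerformed f ε x k → ¬ η < decreaseRatio f p (x k) (s k) →
    x (k + 1) = x k ∧ σr (k + 1) = γ₁ * σ k

/-- The constant `A₀`. -/
noncomputable def constA (p : ℕ) (L η : ℝ) : ℝ :=
  L * (regPower p : ℝ) / (((p : ℝ) + 1) * (1 - η))

/-- The constant `C_R`. -/
noncomputable def constCR (p : ℕ) (Λ : ℕ → ℝ) (R : ℝ) : ℝ :=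
  (regPower p : ℝ) / 2 * (∑ j ∈ Finset.Icc 3 p, 2 * Λ j / R) ^ (regPower p - 2)

/-! The bound rests on two estimates, combined by induction on the iteration.

(1) Bound on `sigmaBar`. Write `H` for the Hessian of `f` at the iterate and let `τ ≥ 1`. With `σ =
p' (δ/2) τ^(p'-2)`, the model is an affine function, plus `½ sᵀ(H - (δ - c)I)s`, plus `δ/(2τ²)`
times `‖τs‖² + ‖τs‖^p' + q(τs)`, where `q` carries the Taylor terms of order at least 3. The
quadratic form is positive semidefinite because `λ + c ≥ δ`. The last summand is SoS-convex once the
coefficients of `q` are at most `R`, which holds when `δτ ≥ ∑ 2Λ_j/R`. Taking `τ = max 1 (S/δ)` with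
`S = ∑ 2Λ_j/R` gives `p'δ/2` or `C_R δ^(3-p')` (`isSosConvex_sosModel`, `sigmaBar_le_max`).

(2) Success for large `σ`. The Lipschitz bound controls the Taylor error, while minimality of `s`
makes the predicted decrease at least `σ/p' ‖s‖^p'`. So `σ ≥ A₀` forces `ρ > η`
(`lt_decreaseRatio`), and a failure can only raise the parameter to at most `γ₁A₀`.

A radius `R` exists because the Hessian of `‖s‖² + ‖s‖^p'` exceeds `2(1 + ‖s‖^(p-1))I` by an
SoS-matrix, and a multiple of `(1 + ‖s‖^(p-1))I` dominates the Hessian of each monomial of degree at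
most `p` (`exists_isSosRadius`). -/

/-! ### The cone of SoS-matrices. -/

theorem vecMulVec_single_single {ι R : Type*} [DecidableEq ι] [CommSemiring R] (i j : ι) (x y : R) :
    Matrix.vecMulVec (Pi.single i x) (Pi.single j y) = Matrix.single i j (x * y) := by
  ext1 k l
  simp only [Matrix.single_apply, Matrix.vecMulVec_apply, Pi.single_apply]
  grind

namespace IsSosMatrix

variable {n : ℕ} {H K : Matrix (Fin n) (Fin n) (MvPolynomial (Fin n) ℝ)}

theorem of_fintype {ι : Type*} [Fintype ι] (V : Matrix ι (Fin n) (MvPolynomial (Fin n) ℝ)) :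
    IsSosMatrix (V.transpose * V) := by
  let e := Fintype.equivFin ι
  refine ⟨Fintype.card ι, V.submatrix e.symm id, ?_⟩
  rw [Matrix.transpose_submatrix, Matrix.submatrix_mul_equiv, Matrix.submatrix_id_id]

theorem zero : IsSosMatrix (0 : Matrix (Fin n) (Fin n) (MvPolynomial (Fin n) ℝ)) :=
  ⟨0, 0, by simp⟩

theorem add (hH : IsSosMatrix H) (hK : IsSosMatrix K) : IsSosMatrix (H + K) := by
  obtain ⟨r, V, rfl⟩ := hH
  obtain ⟨t, W, rfl⟩ := hK
  have := of_fintype (Matrix.fromRows V W)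
  rwa [Matrix.transpose_fromRows, Matrix.fromCols_mul_fromRows] at this

theorem sum {ι : Type*} (s : Finset ι)
    {F : ι → Matrix (Fin n) (Fin n) (MvPolynomial (Fin n) ℝ)}
    (h : ∀ i ∈ s, IsSosMatrix (F i)) : IsSosMatrix (∑ i ∈ s, F i) :=
  Finset.sum_induction _ _ (fun _ _ => add) zero h

theorem smul {g : MvPolynomial (Fin n) ℝ} (hg : IsSumSq g) (hH : IsSosMatrix H) :
    IsSosMatrix (g • H) := by
  induction hg with
  | zero => simpa using zero
  | sq_add a _ ih =>
    rw [add_smul]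
    refine add ?_ ih
    obtain ⟨r, V, rfl⟩ := hH
    refine ⟨r, a • V, ?_⟩
    rw [Matrix.transpose_smul, Matrix.smul_mul, Matrix.mul_smul, smul_smul]

theorem vecMulVec_self (v : Fin n → MvPolynomial (Fin n) ℝ) :
    IsSosMatrix (Matrix.vecMulVec v v) := by
  convert of_fintype (ι := Unit) (Matrix.replicateRow Unit v) using 1
  ext i j
  simp [Matrix.vecMulVec_apply, Matrix.mul_apply]

theorem single (i : Fin n) : IsSosMatrix (Matrix.single i i (1 : MvPolynomial (Fin n) ℝ)) := by
  convert vecMulVec_self (Pi.single i (1 : MvPolynomial (Fin n) ℝ)) using 1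
  rw [vecMulVec_single_single, mul_one]

theorem one : IsSosMatrix (1 : Matrix (Fin n) (Fin n) (MvPolynomial (Fin n) ℝ)) := by
  rw [← Matrix.sum_single_one]
  exact sum _ fun i _ => single i

end IsSosMatrix

theorem isSumSq_C {n : ℕ} {c : ℝ} (hc : 0 ≤ c) :
    IsSumSq (MvPolynomial.C c : MvPolynomial (Fin n) ℝ) := by
  rw [← Real.mul_self_sqrt hc, map_mul]
  exact .mul_self _

/-! ### Hessians of polynomials and dilations. -/

section polyHessian

variable {n : ℕ}

open MvPolynomial

theorem polyHessian_add (p q : MvPolynomial (Fin n) ℝ) :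
    polyHessian (p + q) = polyHessian p + polyHessian q := by
  ext1 i j
  simp [polyHessian]

theorem polyHessian_C_mul (c : ℝ) (q : MvPolynomial (Fin n) ℝ) :
    polyHessian (C c * q) = (C c : MvPolynomial (Fin n) ℝ) • polyHessian q := by
  ext1 i j
  simp [polyHessian]

theorem polyHessian_C (c : ℝ) : polyHessian (C c : MvPolynomial (Fin n) ℝ) = 0 := by
  ext1 i j
  simp [polyHessian]

theorem polyHessian_X (k : Fin n) : polyHessian (X k : MvPolynomial (Fin n) ℝ) = 0 := by
  ext1 i j
  simp only [polyHessian, Matrix.of_apply, pderiv_X, Pi.single_apply, Matrix.zero_apply]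
  split_ifs <;> simp

theorem polyHessian_sum {ι : Type*} (s : Finset ι) (F : ι → MvPolynomial (Fin n) ℝ) :
    polyHessian (∑ i ∈ s, F i) = ∑ i ∈ s, polyHessian (F i) := by
  ext1 i j
  simp [polyHessian, Matrix.sum_apply]

theorem polyHessian_transpose (q : MvPolynomial (Fin n) ℝ) :
    (polyHessian q).transpose = polyHessian q := by
  ext1 i j
  simp only [polyHessian, Matrix.transpose_apply, Matrix.of_apply]
  induction q using MvPolynomial.induction_on with
  | C a => simp
  | add p q hp hq => simp [hp, hq]
  | mul_X p k hp =>
    have h : ∀ a b : Fin n, pderiv a (Pi.single (M := fun _ => MvPolynomial (Fin n) ℝ) b 1 k) = 0 := by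
      intro a b
      rw [Pi.single_apply]
      split_ifs <;> simp
    simp only [Derivation.leibniz, pderiv_X, smul_eq_mul, map_add, h, hp, mul_zero, zero_add]
    ring

/-- The polynomial `q (t s)`. -/
noncomputable def dilate (t : ℝ) : MvPolynomial (Fin n) ℝ →ₐ[ℝ] MvPolynomial (Fin n) ℝ :=
  aeval fun i => C t * X i

theorem eval_dilate (t : ℝ) (q : MvPolynomial (Fin n) ℝ) (x : Fin n → ℝ) :
    eval x (dilate t q) = eval (fun i => t * x i) q := by
  induction q using MvPolynomial.induction_on with
  | C a => simp [dilate]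
  | add p q hp hq => simp [hp, hq]
  | mul_X p k hp => simp [hp]; simp [dilate]

theorem pderiv_dilate (t : ℝ) (q : MvPolynomial (Fin n) ℝ) (i : Fin n) :
    pderiv i (dilate t q) = C t * dilate t (pderiv i q) := by
  induction q using MvPolynomial.induction_on with
  | C a => simp [dilate]
  | add p q hp hq => simp [hp, hq, mul_add]
  | mul_X p k hp =>
    have h : dilate t (Pi.single (M := fun _ => MvPolynomial (Fin n) ℝ) i 1 k) =
        Pi.single (M := fun _ => MvPolynomial (Fin n) ℝ) i 1 k := by
      rw [Pi.single_apply]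
      split_ifs <;> simp
    have hX : dilate t (X k : MvPolynomial (Fin n) ℝ) = C t * X k := by simp [dilate]
    simp only [map_mul, map_add, Derivation.leibniz, pderiv_X, smul_eq_mul, hp, hX, h, pderiv_C]
    ring

theorem polyHessian_dilate (t : ℝ) (q : MvPolynomial (Fin n) ℝ) :
    polyHessian (dilate t q) =
      (C (t * t) : MvPolynomial (Fin n) ℝ) • (polyHessian q).map (dilate t) := by
  ext1 i j
  simp [polyHessian, pderiv_dilate, mul_assoc]

end polyHessian

/-! ### The cone of SoS-convex functions. -/

namespace IsSosConvex

variable {n : ℕ} {g h : RSpace n → ℝ}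

open MvPolynomial

theorem add (hg : IsSosConvex g) (hh : IsSosConvex h) : IsSosConvex fun s => g s + h s := by
  obtain ⟨p, hp, hp'⟩ := hg
  obtain ⟨q, hq, hq'⟩ := hh
  exact ⟨p + q, fun s => by simp [hp, hq], polyHessian_add p q ▸ hp'.add hq'⟩

theorem const_mul {c : ℝ} (hc : 0 ≤ c) (hg : IsSosConvex g) : IsSosConvex fun s => c * g s := by
  obtain ⟨p, hp, hp'⟩ := hg
  exact ⟨C c * p, fun s => by simp [hp], polyHessian_C_mul c p ▸ hp'.smul (isSumSq_C hc)⟩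

theorem comp_smul (t : ℝ) (hg : IsSosConvex g) : IsSosConvex fun s => g (t • s) := by
  obtain ⟨p, hp, r, V, hV⟩ := hg
  refine ⟨dilate t p, fun s => by simp [hp, eval_dilate], ?_⟩
  rw [polyHessian_dilate]
  refine IsSosMatrix.smul (isSumSq_C (mul_self_nonneg t)) ⟨r, V.map (dilate t), ?_⟩
  rw [hV, Matrix.map_mul, Matrix.transpose_map]

theorem affine (a : ℝ) (b : Fin n → ℝ) : IsSosConvex fun s : RSpace n => a + ∑ i, b i * s i := by
  refine ⟨C a + ∑ i, C (b i) * X i, fun s => by simp, ?_⟩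
  rw [polyHessian_add, polyHessian_C, polyHessian_sum]
  simp only [polyHessian_C_mul, polyHessian_X, smul_zero, Finset.sum_const_zero, add_zero]
  exact .zero

/-- A positive semidefinite quadratic form is SoS-convex. -/
theorem quadratic {A : Matrix (Fin n) (Fin n) ℝ} (hA : A.PosSemidef) :
    IsSosConvex fun s : RSpace n => 1 / 2 * ∑ i, ∑ j, A i j * (s i * s j) := by
  refine ⟨C (1 / 2) * ∑ i, ∑ j, C (A i j) * (X i * X j), fun s => by simp, ?_⟩
  have hH : polyHessian (C (1 / 2) * ∑ i, ∑ j, C (A i j) * (X i * X j)) =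
      A.map (C : ℝ →+* MvPolynomial (Fin n) ℝ) := by
    have hsymm : ∀ i j, A i j = A j i := fun i j => by
      simpa using congrFun (congrFun hA.isHermitian j) i
    ext1 k l
    have h : ∀ a b : Fin n, pderiv a (Pi.single (M := fun _ => MvPolynomial (Fin n) ℝ) l 1 b) = 0 := by
      intro a b
      rw [Pi.single_apply]
      split_ifs <;> simp
    simp only [polyHessian, Matrix.of_apply, map_sum, Derivation.leibniz, pderiv_X,
      pderiv_C, smul_eq_mul, map_add, h, mul_zero, zero_add, add_zero, Matrix.map_apply]
    have h1 : ∀ i j : Fin n, (C (A i j) : MvPolynomial (Fin n) ℝ) *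
        ((Pi.single (M := fun _ => MvPolynomial (Fin n) ℝ) l 1 j) *
          (Pi.single (M := fun _ => MvPolynomial (Fin n) ℝ) k 1 i) +
        (Pi.single (M := fun _ => MvPolynomial (Fin n) ℝ) l 1 i) *
          (Pi.single (M := fun _ => MvPolynomial (Fin n) ℝ) k 1 j)) =
        (if j = l then (if i = k then C (A i j) else 0) else 0) +
        (if j = k then (if i = l then C (A i j) else 0) else 0) := by
      intro i j
      simp only [Pi.single_apply]
      split_ifs <;> simp
      ring
    simp only [h1, Finset.sum_add_distrib, Finset.sum_ite_eq', Finset.mem_univ, if_true]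
    rw [hsymm l k, ← two_mul, ← mul_assoc, ← map_ofNat C 2, ← map_mul]
    norm_num
  -- The Hessian is the constant matrix `A`, so a real factorization `A = BᵀB` already serves as the
  -- polynomial one.
  obtain ⟨B, hB⟩ : ∃ B : Matrix (Fin n) (Fin n) ℝ, A = star B * B := by
    open scoped MatrixOrder ComplexOrder in
    exact CStarAlgebra.nonneg_iff_eq_star_mul_self.mp hA.nonneg
  rw [hH, hB, Matrix.star_eq_conjTranspose, Matrix.conjTranspose_eq_transpose_of_trivial,
    Matrix.map_mul, Matrix.transpose_map]
  exact .of_fintype _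

end IsSosConvex

/-! ### Domination by `(1 + ‖s‖^(2e))I` and existence of the radius `R`. -/

theorem IsSumSq.pow' {R : Type*} [CommSemiring R] {a : R} (ha : IsSumSq a) (k : ℕ) :
    IsSumSq (a ^ k) := by
  simpa using IsSumSq.prod (I := Finset.range k) (x := fun _ => a) fun _ _ => ha

section

open MvPolynomial

variable {n : ℕ}

/-- The polynomial `‖s‖²`. -/
noncomputable def normSqPoly (n : ℕ) : MvPolynomial (Fin n) ℝ := ∑ i, X i ^ 2

theorem eval_normSqPoly (s : RSpace n) : eval (fun i => s i) (normSqPoly n) = ‖s‖ ^ 2 := by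
  simp [normSqPoly, EuclideanSpace.norm_sq_eq]

theorem isSumSq_normSqPoly_pow (k : ℕ) : IsSumSq (normSqPoly n ^ k) :=
  (IsSumSq.sum_sq _ _).pow' k

/-- The property is multiplicative in the monomial, by `ab - (xy)² = (a - x²)b + x²(b - y²)`; for a
single variable the difference is the sum of the other squares. -/
theorem isSumSq_normSqPoly_pow_degree_sub (m : Fin n →₀ ℕ) :
    IsSumSq (normSqPoly n ^ m.degree - monomial m 1 ^ 2) := by
  have key : ∀ {a b x y : MvPolynomial (Fin n) ℝ}, IsSumSq b → IsSumSq (a - x ^ 2) →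
      IsSumSq (b - y ^ 2) → IsSumSq (a * b - (x * y) ^ 2) := by
    intro a b x y hb hx hy
    have : a * b - (x * y) ^ 2 = (a - x ^ 2) * b + x * x * (b - y ^ 2) := by ring
    rw [this]
    exact (hx.mul hb).add ((IsSumSq.mul_self x).mul hy)
  have hadd : ∀ m m' : Fin n →₀ ℕ, IsSumSq (normSqPoly n ^ m.degree - monomial m 1 ^ 2) →
      IsSumSq (normSqPoly n ^ m'.degree - monomial m' 1 ^ 2) →
      IsSumSq (normSqPoly n ^ (m + m').degree - monomial (m + m') 1 ^ 2) := by
    intro m m' h h'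
    have := key (isSumSq_normSqPoly_pow _) h h'
    rwa [← pow_add, monomial_mul, one_mul, ← map_add] at this
  have hzero : IsSumSq (normSqPoly n ^ (0 : Fin n →₀ ℕ).degree - monomial 0 1 ^ 2) := by simp
  have hone : ∀ i, IsSumSq (normSqPoly n ^ (Finsupp.single i 1).degree -
      monomial (Finsupp.single i 1) 1 ^ 2) := by
    intro i
    rw [Finsupp.degree_single, pow_one, normSqPoly, ← Finset.add_sum_erase _ _ (Finset.mem_univ i)]
    simp only [X, add_sub_cancel_left]
    exact IsSumSq.sum_sq _ _
  induction m using Finsupp.induction_linear with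
  | zero => exact hzero
  | add m m' h h' => exact hadd m m' h h'
  | single i k =>
    induction k with
    | zero => simp
    | succ k ih =>
      rw [Finsupp.single_add]
      exact hadd _ _ ih (hone i)

/-- With `e = j + l` the expression is `(1 - a^j)(1 - a^l) + a^l`, and both factors share `1 - a`,
which therefore appears squared next to two geometric sums. -/
theorem isSumSq_one_add_pow_sub_pow {a : MvPolynomial (Fin n) ℝ} (ha : IsSumSq a) {j e : ℕ}
    (hj : j ≤ e) : IsSumSq (1 + a ^ e - a ^ j) := by
  obtain ⟨l, rfl⟩ := Nat.exists_eq_add_of_le hj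
  have hg : ∀ k, IsSumSq (∑ i ∈ Finset.range k, a ^ i) := fun k => .sum fun i _ => ha.pow' i
  have : 1 + a ^ (j + l) - a ^ j = (1 - a) * (1 - a) *
      ((∑ i ∈ Finset.range j, a ^ i) * ∑ i ∈ Finset.range l, a ^ i) + a ^ l := by
    have h1 := geom_sum_mul_neg a j
    have h2 := geom_sum_mul_neg a l
    linear_combination (-(∑ i ∈ Finset.range l, a ^ i) * (1 - a)) * h1 - (1 - a ^ j) * h2
  rw [this]
  exact ((IsSumSq.mul_self _).mul ((hg j).mul (hg l))).add (ha.pow' l)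

theorem isSumSq_one_add_normSqPoly_pow_sub {m : Fin n →₀ ℕ} {e : ℕ} (hm : m.degree ≤ e) :
    IsSumSq (1 + normSqPoly n ^ e - monomial m 1 ^ 2) := by
  have := (isSumSq_one_add_pow_sub_pow (by simpa using isSumSq_normSqPoly_pow (n := n) 1) hm).add
    (isSumSq_normSqPoly_pow_degree_sub m)
  rwa [sub_add_sub_cancel] at this

/-- The matrix `(1 + ‖s‖^(2e)) I`. -/
noncomputable def growthMatrix (n e : ℕ) : Matrix (Fin n) (Fin n) (MvPolynomial (Fin n) ℝ) :=
  (1 + normSqPoly n ^ e) • 1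

theorem isSosMatrix_growthMatrix (e : ℕ) : IsSosMatrix (growthMatrix n e) :=
  .smul (IsSumSq.one.add (isSumSq_normSqPoly_pow e)) .one

theorem isSosMatrix_growthMatrix_sub_single {m : Fin n →₀ ℕ} {e : ℕ} (hm : m.degree ≤ e)
    (i : Fin n) :
    IsSosMatrix (growthMatrix n e - Matrix.single i i (monomial m (1 : ℝ) ^ 2)) := by
  have h1 : growthMatrix n e - Matrix.single i i (monomial m (1 : ℝ) ^ 2) =
      (1 + normSqPoly n ^ e) • (∑ k ∈ Finset.univ.erase i, Matrix.single k k 1) +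
      (1 + normSqPoly n ^ e - monomial m 1 ^ 2) • Matrix.single i i 1 := by
    rw [growthMatrix, ← Matrix.sum_single_one, ← Finset.add_sum_erase _ _ (Finset.mem_univ i),
      sub_smul, smul_add]
    have : Matrix.single i i ((monomial m (1 : ℝ)) ^ 2) =
        (monomial m (1 : ℝ)) ^ 2 • Matrix.single i i (1 : MvPolynomial (Fin n) ℝ) := by
      simp [Matrix.smul_single]
    rw [this]
    abel
  rw [h1]
  exact (IsSosMatrix.smul (IsSumSq.one.add (isSumSq_normSqPoly_pow e))
    (.sum _ fun k _ => .single k)).add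
    (.smul (isSumSq_one_add_normSqPoly_pow_sub hm) (.single i))

/-- `H` is dominated by a multiple of `(1 + ‖s‖^(2e)) I` in the order defined by SoS-matrices. -/
def IsSosDominated (e : ℕ) (H : Matrix (Fin n) (Fin n) (MvPolynomial (Fin n) ℝ)) : Prop :=
  ∃ B : ℝ, 0 ≤ B ∧ IsSosMatrix ((C B : MvPolynomial (Fin n) ℝ) • growthMatrix n e + H) ∧
    IsSosMatrix ((C B : MvPolynomial (Fin n) ℝ) • growthMatrix n e - H)

theorem isSosMatrix_abs_smul_add {G H : Matrix (Fin n) (Fin n) (MvPolynomial (Fin n) ℝ)} {B : ℝ}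
    (h1 : IsSosMatrix ((C B : MvPolynomial (Fin n) ℝ) • G + H))
    (h2 : IsSosMatrix ((C B : MvPolynomial (Fin n) ℝ) • G - H)) (c : ℝ) :
    IsSosMatrix ((C (|c| * B) : MvPolynomial (Fin n) ℝ) • G +
      (C c : MvPolynomial (Fin n) ℝ) • H) := by
  rcases le_total 0 c with hc | hc
  · convert h1.smul (isSumSq_C hc) using 1
    rw [abs_of_nonneg hc, map_mul, smul_add, smul_smul]
  · convert h2.smul (isSumSq_C (neg_nonneg.2 hc)) using 1
    rw [abs_of_nonpos hc, map_mul, smul_sub, smul_smul, map_neg, neg_smul (C c) H, sub_neg_eq_add]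

namespace IsSosDominated

variable {e : ℕ} {H K : Matrix (Fin n) (Fin n) (MvPolynomial (Fin n) ℝ)}

theorem zero : IsSosDominated e (0 : Matrix (Fin n) (Fin n) (MvPolynomial (Fin n) ℝ)) :=
  ⟨0, le_rfl, by simpa using IsSosMatrix.zero, by simpa using IsSosMatrix.zero⟩

theorem add (hH : IsSosDominated e H) (hK : IsSosDominated e K) : IsSosDominated e (H + K) := by
  obtain ⟨B, hB, h1, h2⟩ := hH
  obtain ⟨D, hD, k1, k2⟩ := hK
  refine ⟨B + D, add_nonneg hB hD, ?_, ?_⟩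
  · convert h1.add k1 using 1
    rw [map_add, add_smul]
    abel
  · convert h2.add k2 using 1
    rw [map_add, add_smul]
    abel

theorem sum {ι : Type*} (s : Finset ι)
    {F : ι → Matrix (Fin n) (Fin n) (MvPolynomial (Fin n) ℝ)}
    (h : ∀ i ∈ s, IsSosDominated e (F i)) : IsSosDominated e (∑ i ∈ s, F i) :=
  Finset.sum_induction _ _ (fun _ _ => add) zero h

theorem C_smul (c : ℝ) (hH : IsSosDominated e H) :
    IsSosDominated e ((C c : MvPolynomial (Fin n) ℝ) • H) := by
  obtain ⟨B, hB, h1, h2⟩ := hH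
  refine ⟨|c| * B, by positivity, isSosMatrix_abs_smul_add h1 h2 c, ?_⟩
  convert isSosMatrix_abs_smul_add h1 h2 (-c) using 1
  rw [abs_neg, map_neg, neg_smul, sub_eq_add_neg]

theorem exists_add_eq_of_degree_le_two_mul {m : Fin n →₀ ℕ} (hm : m.degree ≤ 2 * e) :
    ∃ a b : Fin n →₀ ℕ, a + b = m ∧ a.degree ≤ e ∧ b.degree ≤ e := by
  rcases le_total m.degree e with h | h
  · exact ⟨m, 0, add_zero m, h, by simp⟩
  · obtain ⟨a, ham, ha⟩ := Finsupp.exists_le_degree_eq m e h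
    obtain ⟨b, rfl⟩ := exists_add_of_le ham
    rw [map_add] at hm
    exact ⟨a, b, rfl, ha.le, by omega⟩

/-- Split `m = a + b` with both degrees at most `e`. The rank-one matrices of `s^a e_i ± s^b e_j`
produce the off-diagonal terms with either sign, at the price of diagonal squares; each of the two
is absorbed by one copy of `growthMatrix`, whence the constant 2. -/
theorem monomial_single {m : Fin n →₀ ℕ} (hm : m.degree ≤ 2 * e) (i j : Fin n) :
    IsSosDominated e (Matrix.single i j (monomial m (1 : ℝ)) +
      Matrix.single j i (monomial m (1 : ℝ))) := by
  obtain ⟨a, b, rfl, ha, hb⟩ := exists_add_eq_of_degree_le_two_mul hm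
  have hv : ∀ u : MvPolynomial (Fin n) ℝ, u * u = 1 →
      IsSosMatrix (Matrix.single i i (monomial a (1 : ℝ) ^ 2) +
        Matrix.single j j (monomial b (1 : ℝ) ^ 2) +
        u • (Matrix.single i j (monomial (a + b) (1 : ℝ)) +
          Matrix.single j i (monomial (a + b) (1 : ℝ)))) := by
    intro u hu
    convert IsSosMatrix.vecMulVec_self (Pi.single i (monomial a (1 : ℝ)) +
      u • Pi.single j (monomial b (1 : ℝ))) using 1
    have hab : (monomial (a + b) (1 : ℝ)) = monomial a 1 * monomial b 1 := by
      rw [monomial_mul, one_mul]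
    rw [Matrix.add_vecMulVec, Matrix.vecMulVec_add, Matrix.vecMulVec_add, Matrix.smul_vecMulVec,
      Matrix.smul_vecMulVec, Matrix.vecMulVec_smul, Matrix.vecMulVec_smul, smul_smul, hu, one_smul]
    simp only [vecMulVec_single_single, hab, smul_add, sq]
    rw [mul_comm (monomial b (1 : ℝ)) (monomial a 1)]
    abel
  have hw := (isSosMatrix_growthMatrix_sub_single ha i).add
    (isSosMatrix_growthMatrix_sub_single hb j)
  refine ⟨2, by norm_num, ?_, ?_⟩
  · convert hw.add (hv 1 (by simp)) using 1
    rw [map_ofNat, two_smul, one_smul]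
    abel
  · convert hw.add (hv (-1) (by simp)) using 1
    rw [map_ofNat, two_smul, neg_one_smul]
    abel

/-- Symmetric polynomial matrices of degree at most `2e` are dominated. -/
theorem of_totalDegree_le (hH : H.transpose = H) (hdeg : ∀ i j, (H i j).totalDegree ≤ 2 * e) :
    IsSosDominated e H := by
  -- Symmetry allows `H` to be replaced by `½(H + Hᵀ)`, which is a combination of the matrices in
  -- `monomial_single`.
  have h : H = (C (1 / 2) : MvPolynomial (Fin n) ℝ) • ∑ i, ∑ j, ∑ m ∈ (H i j).support,
      (C ((H i j).coeff m) : MvPolynomial (Fin n) ℝ) •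
        (Matrix.single i j (monomial m (1 : ℝ)) + Matrix.single j i (monomial m (1 : ℝ))) := by
    have h1 : ∀ i j, ∑ m ∈ (H i j).support, (C ((H i j).coeff m) : MvPolynomial (Fin n) ℝ) •
        (Matrix.single i j (monomial m (1 : ℝ)) + Matrix.single j i (monomial m (1 : ℝ))) =
        Matrix.single i j (H i j) + (Matrix.single i j (H i j)).transpose := by
      intro i j
      have h2 : ∀ c : ℝ, ∀ m : Fin n →₀ ℕ, ∀ i j : Fin n, (C c : MvPolynomial (Fin n) ℝ) •
          Matrix.single i j (monomial m (1 : ℝ)) = Matrix.single i j (monomial m c) := by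
        intro c m i j
        rw [Matrix.smul_single, smul_eq_mul, C_mul_monomial, mul_one]
      simp only [smul_add, h2, Finset.sum_add_distrib, Matrix.transpose_single]
      conv_rhs => rw [(H i j).as_sum]
      rw [← Matrix.singleAddMonoidHom_apply, ← Matrix.singleAddMonoidHom_apply, map_sum, map_sum]
      rfl
    simp only [h1, Finset.sum_add_distrib, ← Matrix.transpose_sum, ← Matrix.matrix_eq_sum_single]
    rw [hH, ← two_smul (MvPolynomial (Fin n) ℝ) H, smul_smul, ← map_ofNat (C : ℝ →+* MvPolynomial (Fin n) ℝ) 2, ← map_mul]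
    norm_num
  rw [h]
  refine C_smul _ (sum _ fun i _ => sum _ fun j _ => sum _ fun m hm => C_smul _ ?_)
  refine monomial_single (le_trans ?_ (hdeg i j)) i j
  exact le_totalDegree hm

end IsSosDominated

theorem polyHessian_normSqPoly_pow (k : ℕ) : polyHessian (normSqPoly n ^ (k + 1)) =
    (C (2 * (k + 1) : ℝ) * normSqPoly n ^ k) • (1 : Matrix (Fin n) (Fin n) (MvPolynomial (Fin n) ℝ)) +
      (C (4 * (k + 1) * k : ℝ) * normSqPoly n ^ (k - 1)) • Matrix.vecMulVec X X := by
  have hX : ∀ i : Fin n, pderiv i (normSqPoly n) = 2 * X i := by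
    intro i
    simp [normSqPoly, Derivation.leibniz_pow, pderiv_X, Pi.single_apply]
  ext1 i j
  simp only [polyHessian, Matrix.of_apply, Derivation.leibniz_pow, hX, Matrix.add_apply,
    Matrix.smul_apply, Matrix.vecMulVec_apply, smul_eq_mul, Derivation.leibniz, nsmul_eq_mul,
    map_mul, pderiv_X, Matrix.one_apply]
  have h4 : (C 2 : MvPolynomial (Fin n) ℝ) = 2 ∧ (C 4 : MvPolynomial (Fin n) ℝ) = 4 :=
    ⟨map_ofNat C 2, map_ofNat C 4⟩
  have h2 : ∀ i, pderiv i (2 : MvPolynomial (Fin n) ℝ) = 0 := fun i => by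
    rw [← map_ofNat (C : ℝ →+* MvPolynomial (Fin n) ℝ) 2, pderiv_C]
  rcases k with _ | k <;> by_cases hij : i = j <;> simp [h2, h4, hij] <;> ring

theorem totalDegree_pderiv_monomial_le (m : Fin n →₀ ℕ) (c : ℝ) (i : Fin n) :
    (pderiv i (monomial m c)).totalDegree ≤ m.degree - 1 := by
  rw [pderiv_monomial]
  rcases Nat.eq_zero_or_pos (m i) with h | h
  · simp [h]
  · refine (totalDegree_monomial_le _ _).trans ?_
    have hm : m = (m - Finsupp.single i 1) + Finsupp.single i 1 :=
      (tsub_add_cancel_of_le (Finsupp.single_le_iff.2 h)).symm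
    have := congrArg Finsupp.degree hm
    rw [map_add, Finsupp.degree_single] at this
    change (m - Finsupp.single i 1).degree ≤ _
    omega

theorem exists_isSosRadius {p : ℕ} (hp : 3 ≤ p) (hodd : Odd p) : ∃ R : ℝ, IsSosRadius n p R := by
  obtain ⟨e, rfl⟩ := hodd
  have hdom : ∀ m : Fin n →₀ ℕ, m.degree ≤ 2 * e + 1 →
      IsSosDominated e (polyHessian (monomial m (1 : ℝ))) := by
    intro m hm
    refine .of_totalDegree_le (polyHessian_transpose _) fun i j => ?_
    simp only [polyHessian, Matrix.of_apply]
    rw [pderiv_monomial (i := j)]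
    refine (totalDegree_pderiv_monomial_le _ _ _).trans ?_
    have := Finsupp.degree_mono (tsub_le_self : m - Finsupp.single j 1 ≤ m)
    omega
  let S : Finset (Fin n →₀ ℕ) := (Finsupp.finite_of_degree_le (2 * e + 1)).toFinset
  choose! B hB hB1 hB2 using hdom
  have hBS : 0 ≤ ∑ m ∈ S, B m := Finset.sum_nonneg fun m hm => hB m (by simpa [S] using hm)
  -- This choice makes the total domination constant `∑ |q_m| B_m` at most 1, below the 2 available;
  -- the added 1 keeps the denominator positive.
  refine ⟨1 / (1 + ∑ m ∈ S, B m), by positivity, fun q hq hcoeff => ?_⟩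
  have hsupp : q.support ⊆ S := by
    intro m hm
    have h : m.degree ≤ 2 * e + 1 := (le_totalDegree hm).trans hq
    simpa [S] using h
  refine ⟨normSqPoly n + normSqPoly n ^ (e + 1) + q, fun s => ?_, ?_⟩
  · have : regPower (2 * e + 1) = 2 * (e + 1) := by
      simp only [regPower]
      split_ifs <;> omega
    simp [eval_normSqPoly, this, pow_mul]
  have hqH : polyHessian q = ∑ m ∈ S, (C (q.coeff m) : MvPolynomial (Fin n) ℝ) •
      polyHessian (monomial m (1 : ℝ)) := by
    conv_lhs => rw [q.as_sum, polyHessian_sum]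
    rw [Finset.sum_subset hsupp]
    · refine Finset.sum_congr rfl fun m _ => ?_
      rw [← polyHessian_C_mul, C_mul_monomial, mul_one]
    · intro m _ hm
      rw [notMem_support_iff.1 hm, map_zero, ← C_0, polyHessian_C]
  have hκ : ∑ m ∈ S, |q.coeff m| * B m ≤ 1 := by
    calc ∑ m ∈ S, |q.coeff m| * B m ≤ ∑ m ∈ S, 1 / (1 + ∑ m ∈ S, B m) * B m :=
          Finset.sum_le_sum fun m hm => mul_le_mul_of_nonneg_right (hcoeff m)
            (hB m (by simpa [S] using hm))
      _ ≤ 1 := by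
          rw [← Finset.mul_sum, one_div_mul_eq_div, div_le_one (by positivity)]
          linarith
  have h1 : IsSosMatrix ((C (∑ m ∈ S, |q.coeff m| * B m) : MvPolynomial (Fin n) ℝ) •
      growthMatrix n e + polyHessian q) := by
    rw [hqH, map_sum, Finset.sum_smul, ← Finset.sum_add_distrib]
    refine .sum _ fun m hm => isSosMatrix_abs_smul_add (hB1 m ?_) (hB2 m ?_) _ <;>
      simpa [S] using hm
  have h2 := (isSosMatrix_growthMatrix (n := n) e).smul
    (isSumSq_C (n := n) (c := 2 - ∑ m ∈ S, |q.coeff m| * B m) (by linarith))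
  have h3 : IsSosMatrix ((C (2 * e : ℝ) * normSqPoly n ^ e) •
      (1 : Matrix (Fin n) (Fin n) (MvPolynomial (Fin n) ℝ))) :=
    .smul ((isSumSq_C (by positivity)).mul (isSumSq_normSqPoly_pow e)) .one
  have h4 : IsSosMatrix ((C (4 * (e + 1) * e : ℝ) * normSqPoly n ^ (e - 1)) •
      (Matrix.vecMulVec X X : Matrix (Fin n) (Fin n) (MvPolynomial (Fin n) ℝ))) :=
    .smul ((isSumSq_C (by positivity)).mul (isSumSq_normSqPoly_pow _)) (.vecMulVec_self X)
  -- `h1` and `h2` together use up `2(1 + ‖s‖^(2e))I`; `h3` and `h4` are what remains of the Hessian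
  -- of `‖s‖^(2e+2)`.
  convert ((h1.add h2).add h3).add h4 using 1
  have h5 := polyHessian_normSqPoly_pow (n := n) 0
  simp only [zero_add, pow_one] at h5
  rw [polyHessian_add, polyHessian_add, polyHessian_normSqPoly_pow, h5]
  have h6 : (C (∑ m ∈ S, |q.coeff m| * B m) : MvPolynomial (Fin n) ℝ) • growthMatrix n e +
      polyHessian q + (C (2 - ∑ m ∈ S, |q.coeff m| * B m) : MvPolynomial (Fin n) ℝ) •
        growthMatrix n e = (C 2 : MvPolynomial (Fin n) ℝ) • growthMatrix n e + polyHessian q := by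
    rw [C_sub, sub_smul]
    abel
  rw [h6, growthMatrix]
  ext1 i j
  simp
  ring

end

/-! ### Coefficients of the forms `T[s]^j`. -/

section

open MvPolynomial

variable {n : ℕ}

theorem sum_smul_single_one (s : RSpace n) :
    ∑ i, s i • (EuclideanSpace.single i (1 : ℝ) : RSpace n) = s := by
  simpa using (EuclideanSpace.basisFun (Fin n) ℝ).sum_repr s

/-- The polynomial `T[s]^j`. -/
noncomputable def formPoly {j : ℕ} (T : ContinuousMultilinearMap ℝ (fun _ : Fin j => RSpace n) ℝ) :
    MvPolynomial (Fin n) ℝ :=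
  ∑ u : Fin j → Fin n, C (T fun k => EuclideanSpace.single (u k) 1) * ∏ k, X (u k)

variable {j : ℕ} (T : ContinuousMultilinearMap ℝ (fun _ : Fin j => RSpace n) ℝ)

theorem eval_formPoly (s : RSpace n) : eval (fun i => s i) (formPoly T) = T fun _ => s := by
  conv_rhs => rw [← sum_smul_single_one s]
  rw [T.map_sum (fun _ i => s i • EuclideanSpace.single i (1 : ℝ))]
  simp only [T.map_smul_univ, formPoly, map_sum, map_mul, eval_C, map_prod, eval_X, smul_eq_mul]
  exact Finset.sum_congr rfl fun u _ => mul_comm _ _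

theorem totalDegree_formPoly_le : (formPoly T).totalDegree ≤ j := by
  refine totalDegree_finsetSum_le fun u _ => (totalDegree_mul _ _).trans ?_
  rw [totalDegree_C, zero_add]
  refine (totalDegree_finsetProd _ _).trans ?_
  simp

theorem coeff_sum_X_pow_le (n j : ℕ) (m : Fin n →₀ ℕ) :
    coeff m ((∑ i : Fin n, X i : MvPolynomial (Fin n) ℝ) ^ j) ≤ j ! := by
  rw [Finset.sum_pow_eq_sum_piAntidiag, coeff_sum]
  have h : ∀ k ∈ Finset.piAntidiag (Finset.univ : Finset (Fin n)) j,
      coeff m ((Nat.multinomial Finset.univ k : MvPolynomial (Fin n) ℝ) *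
        ∏ i, (X i : MvPolynomial (Fin n) ℝ) ^ k i) ≤ if k = m then (j ! : ℝ) else 0 := by
    intro k hk
    have h1 : ∏ i, (X i : MvPolynomial (Fin n) ℝ) ^ k i =
        monomial (Finsupp.equivFunOnFinite.symm k) 1 := by
      rw [monomial_eq, C_1, one_mul, Finsupp.prod_fintype _ _ (by simp)]
      simp
    rw [h1, ← map_natCast (C : ℝ →+* MvPolynomial (Fin n) ℝ), coeff_C_mul, coeff_monomial]
    have h2 : Finsupp.equivFunOnFinite.symm k = m ↔ k = m := by
      rw [Equiv.symm_apply_eq]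
      rfl
    simp only [h2]
    split_ifs
    · have h3 := Nat.multinomial_spec Finset.univ k
      rw [(Finset.mem_piAntidiag.1 hk).1] at h3
      rw [mul_one, ← h3]
      exact_mod_cast Nat.le_mul_of_pos_left _ (Finset.prod_pos fun i _ => Nat.factorial_pos _)
    · simp
  refine (Finset.sum_le_sum h).trans ?_
  rw [Finset.sum_ite_eq']
  split_ifs
  · exact le_rfl
  · exact Nat.cast_nonneg _

/-- Each entry of `T` on basis vectors is at most `‖T‖`, so comparison with `(∑ X_i)^j` leaves a
multinomial coefficient, at most `j!`. This factor cancels the `1/j!` of the Taylor expansion. -/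
theorem abs_coeff_formPoly_le (m : Fin n →₀ ℕ) : |coeff m (formPoly T)| ≤ j ! * ‖T‖ := by
  have hX : ∀ u : Fin j → Fin n, 0 ≤ coeff m (∏ k, (X (u k) : MvPolynomial (Fin n) ℝ)) := by
    intro u
    have : ∏ k, (X (u k) : MvPolynomial (Fin n) ℝ) =
        monomial (∑ k, Finsupp.single (u k) 1) 1 := by
      simp [X, monomial_sum_one]
    rw [this, coeff_monomial]
    split_ifs <;> simp
  have hT : ∀ u : Fin j → Fin n, |T fun k => EuclideanSpace.single (u k) 1| ≤ ‖T‖ := by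
    intro u
    simpa using T.le_opNorm fun k => EuclideanSpace.single (u k) 1
  rw [formPoly, coeff_sum]
  calc |∑ u : Fin j → Fin n, coeff m (C (T fun k => EuclideanSpace.single (u k) 1) * ∏ k, X (u k))|
      ≤ ∑ u : Fin j → Fin n, ‖T‖ * coeff m (∏ k, (X (u k) : MvPolynomial (Fin n) ℝ)) := by
        refine (Finset.abs_sum_le_sum_abs _ _).trans (Finset.sum_le_sum fun u _ => ?_)
        rw [coeff_C_mul, abs_mul, abs_of_nonneg (hX u)]
        exact mul_le_mul_of_nonneg_right (hT u) (hX u)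
    _ = ‖T‖ * coeff m ((∑ i : Fin n, X i : MvPolynomial (Fin n) ℝ) ^ j) := by
        rw [← Finset.mul_sum, ← coeff_sum]
        congr 2
        have := Finset.prod_univ_sum (fun _ : Fin j => (Finset.univ : Finset (Fin n)))
          (fun _ i => (X i : MvPolynomial (Fin n) ℝ))
        simpa [Fintype.piFinset_univ] using this.symm
    _ ≤ j ! * ‖T‖ := by
        rw [mul_comm]
        exact mul_le_mul_of_nonneg_right (coeff_sum_X_pow_le n j m) (norm_nonneg _)

end

/-! ### SoS-convexity of the model and the bound on `sigmaBar`. -/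

section

open MvPolynomial

variable {n p : ℕ} {f : RSpace n → ℝ}

theorem taylorModel_eq_add_sum (hp : 2 ≤ p) (x s : RSpace n) :
    taylorModel f p x s = f x + ∑ i, fderiv ℝ f x (EuclideanSpace.single i 1) * s i +
      1 / 2 * ∑ i, ∑ j, hessianMatrix f x i j * (s i * s j) +
      ∑ j ∈ Finset.Icc 3 p, 1 / (j ! : ℝ) * iteratedFDeriv ℝ j f x (fun _ => s) := by
  have hI : Finset.Icc 1 p = insert 1 (insert 2 (Finset.Icc 3 p)) := by
    ext
    simp only [Finset.mem_Icc, Finset.mem_insert]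
    omega
  have h1 : fderiv ℝ f x s = ∑ i, fderiv ℝ f x (EuclideanSpace.single i 1) * s i := by
    conv_lhs => rw [← sum_smul_single_one s, map_sum]
    exact Finset.sum_congr rfl fun i _ => by rw [map_smul, smul_eq_mul, mul_comm]
  have h2 : fderiv ℝ (fderiv ℝ f) x s s = ∑ i, ∑ j, hessianMatrix f x i j * (s i * s j) := by
    conv_lhs => rw [← sum_smul_single_one s]
    simp only [map_sum, map_smul, sum_apply, smul_apply,
      smul_eq_mul, hessianMatrix, Matrix.of_apply, iteratedFDeriv_two_apply, Matrix.cons_val_zero,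
      Matrix.cons_val_one, Finset.mul_sum]
    rw [Finset.sum_comm]
    exact Finset.sum_congr rfl fun i _ => Finset.sum_congr rfl fun j _ => by ring
  rw [taylorModel, hI, Finset.sum_insert (by simp), Finset.sum_insert (by simp),
    iteratedFDeriv_one_apply, iteratedFDeriv_two_apply, h1, h2]
  simp
  ring

theorem isHermitian_hessianMatrix (hf : ContDiff ℝ p f) (hp : 2 ≤ p) (x : RSpace n) :
    (hessianMatrix f x).IsHermitian := by
  ext i j
  have h : IsSymmSndFDerivAt ℝ f x := hf.contDiffAt.isSymmSndFDerivAt (by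
    rw [minSmoothness_of_isRCLikeNormedField]
    exact_mod_cast hp)
  simpa [hessianMatrix] using h.iteratedFDeriv_cons

theorem posSemidef_sub_of_le_sInf_spectrum {A : Matrix (Fin n) (Fin n) ℝ} (hA : A.IsHermitian)
    {μ : ℝ} (hμ : μ ≤ sInf (spectrum ℝ A)) :
    (A - algebraMap ℝ (Matrix (Fin n) (Fin n) ℝ) μ).PosSemidef := by
  rw [Matrix.posSemidef_iff_isHermitian_and_spectrum_nonneg]
  refine ⟨hA.sub ?_, ?_⟩
  · simp [Matrix.IsHermitian, Matrix.algebraMap_eq_diagonal]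
  · rw [← spectrum.sub_singleton_eq]
    rintro _ ⟨a, ha, _, rfl, rfl⟩
    exact sub_nonneg.2 (hμ.trans (csInf_le (Matrix.finite_spectrum A).bddBelow ha))

theorem IsPerturbation.le_add {δ lam c : ℝ} (h : IsPerturbation δ lam c) : δ ≤ lam + c := by
  rcases h with ⟨h, rfl⟩ | ⟨h, rfl⟩ | ⟨h, h', rfl⟩ <;> linarith

theorem IsPerturbation.nonneg {δ lam c : ℝ} (hδ : 0 ≤ δ) (h : IsPerturbation δ lam c) : 0 ≤ c := by
  rcases h with ⟨h, rfl⟩ | ⟨h, rfl⟩ | ⟨h, h', rfl⟩ <;> linarith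

theorem two_le_regPower (hp : 1 ≤ p) : 2 ≤ regPower p := by
  unfold regPower
  split_ifs <;> omega

theorem isSosConvex_sosModel (hf : ContDiff ℝ p f) (hp : 2 ≤ p) {x : RSpace n} {R δ c τ : ℝ}
    (hR : IsSosRadius n p R) (hδ : 0 < δ) (hc : IsPerturbation δ (lambdaMin f x) c) (hτ : 1 ≤ τ)
    (hτR : ∑ j ∈ Finset.Icc 3 p, 2 * ‖iteratedFDeriv ℝ j f x‖ / R ≤ δ * τ) :
    IsSosConvex (sosModel f p c (regPower p * (δ / 2) * τ ^ (regPower p - 2)) x) := by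
  have hτ0 : 0 < τ := by linarith
  obtain ⟨hR0, hR⟩ := hR
  -- The coefficients are fixed by requiring that `δ/(2τ²) q(τs)` equal the Taylor terms of order at
  -- least 3.
  let q : MvPolynomial (Fin n) ℝ := ∑ j ∈ Finset.Icc 3 p,
    C (2 * τ ^ 2 / (δ * j ! * τ ^ j)) * formPoly (iteratedFDeriv ℝ j f x)
  have hq : q.totalDegree ≤ p := by
    refine totalDegree_finsetSum_le fun j hj => (totalDegree_mul _ _).trans ?_
    rw [totalDegree_C, zero_add]
    exact (totalDegree_formPoly_le _).trans (Finset.mem_Icc.1 hj).2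
  have hqR : ∀ m, |q.coeff m| ≤ R := by
    intro m
    have h1 : ∀ j ∈ Finset.Icc 3 p, |coeff m (C (2 * τ ^ 2 / (δ * j ! * τ ^ j)) *
        formPoly (iteratedFDeriv ℝ j f x))| ≤
        R / (δ * τ) * (2 * ‖iteratedFDeriv ℝ j f x‖ / R) := by
      intro j hj
      have hj3 := (Finset.mem_Icc.1 hj).1
      rw [coeff_C_mul, abs_mul, abs_of_pos (by positivity)]
      refine (mul_le_mul_of_nonneg_left (abs_coeff_formPoly_le _ m) (by positivity)).trans ?_
      have h2 : 2 * τ ^ 2 / (δ * j ! * τ ^ j) * (j ! * ‖iteratedFDeriv ℝ j f x‖) =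
          2 * ‖iteratedFDeriv ℝ j f x‖ / δ * (τ ^ 2 / τ ^ j) := by
        field_simp
      have h3 : R / (δ * τ) * (2 * ‖iteratedFDeriv ℝ j f x‖ / R) =
          2 * ‖iteratedFDeriv ℝ j f x‖ / δ * (1 / τ) := by
        field_simp
      rw [h2, h3]
      refine mul_le_mul_of_nonneg_left ?_ (by positivity)
      -- Here `τ^(2-j) ≤ τ^(-1)`, since `j ≥ 3` and `τ ≥ 1`.
      rw [div_le_div_iff₀ (by positivity) hτ0, one_mul, ← pow_succ]
      exact pow_le_pow_right₀ hτ hj3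
    rw [coeff_sum]
    refine (Finset.abs_sum_le_sum_abs _ _).trans ((Finset.sum_le_sum h1).trans ?_)
    rw [← Finset.mul_sum]
    refine (mul_le_mul_of_nonneg_left hτR (by positivity)).trans_eq ?_
    field_simp
  have hpsd : (hessianMatrix f x - algebraMap ℝ (Matrix (Fin n) (Fin n) ℝ) (δ - c)).PosSemidef :=
    posSemidef_sub_of_le_sInf_spectrum (isHermitian_hessianMatrix hf hp x)
      (by have := hc.le_add; unfold lambdaMin at this; linarith)
  have hmain := ((IsSosConvex.affine (f x)
    fun i => fderiv ℝ f x (EuclideanSpace.single i 1)).add (IsSosConvex.quadratic hpsd)).add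
    (((hR q hq hqR).comp_smul τ).const_mul (c := δ / 2 / τ ^ 2) (by positivity))
  convert hmain using 2 with s
  have hnorm : ∑ i, ∑ j, (hessianMatrix f x - algebraMap ℝ (Matrix (Fin n) (Fin n) ℝ) (δ - c)) i j *
      (s i * s j) = ∑ i, ∑ j, hessianMatrix f x i j * (s i * s j) - (δ - c) * ‖s‖ ^ 2 := by
    simp only [Matrix.sub_apply, sub_mul, Finset.sum_sub_distrib, Matrix.algebraMap_matrix_apply,
      EuclideanSpace.norm_sq_eq, Finset.mul_sum]
    simp [sq, sub_mul]
  have hev : eval (fun i => (τ • s) i) q = τ ^ 2 * (2 / δ) *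
      ∑ j ∈ Finset.Icc 3 p, 1 / (j ! : ℝ) * iteratedFDeriv ℝ j f x (fun _ => s) := by
    simp only [q, map_sum, map_mul, eval_C, eval_formPoly, Finset.mul_sum]
    refine Finset.sum_congr rfl fun j _ => ?_
    rw [ContinuousMultilinearMap.map_smul_univ (iteratedFDeriv ℝ j f x) (fun _ => τ) (fun _ => s)]
    simp only [Finset.prod_const, Finset.card_univ, Fintype.card_fin, smul_eq_mul]
    field_simp
  have hr := two_le_regPower (p := p) (by omega)
  have hpow : τ ^ regPower p = τ ^ (regPower p - 2) * τ ^ 2 := by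
    rw [← pow_add, Nat.sub_add_cancel hr]
  have hr0 : (regPower p : ℝ) ≠ 0 := by positivity
  rw [sosModel, taylorModel_eq_add_sum hp, hnorm, hev, norm_smul, Real.norm_of_nonneg hτ0.le, mul_pow, mul_pow,
    hpow]
  field_simp
  ring

theorem sigmaBar_le_max (hf : ContDiff ℝ p f) (hp : 2 ≤ p) {x : RSpace n} {R δ c : ℝ} {Λ : ℕ → ℝ}
    (hR : IsSosRadius n p R) (hδ : 0 < δ) (hc : IsPerturbation δ (lambdaMin f x) c)
    (hΛ : ∀ j, 1 ≤ j → j ≤ p → ‖iteratedFDeriv ℝ j f x‖ ≤ Λ j) :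
    sigmaBar f p c x ≤ max (regPower p * (δ / 2)) (constCR p Λ R * δ ^ (3 - (regPower p : ℝ))) := by
  have hR0 := hR.1
  have hS : ∀ j ∈ Finset.Icc 3 p, 2 * ‖iteratedFDeriv ℝ j f x‖ / R ≤ 2 * Λ j / R := by
    intro j hj
    have := hΛ j (by have := (Finset.mem_Icc.1 hj).1; omega) (Finset.mem_Icc.1 hj).2
    gcongr
  have hS0 : 0 ≤ ∑ j ∈ Finset.Icc 3 p, 2 * Λ j / R :=
    Finset.sum_nonneg fun j hj => le_trans (by positivity) (hS j hj)
  have hr := two_le_regPower (p := p) (by omega)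
  unfold constCR
  set S := ∑ j ∈ Finset.Icc 3 p, 2 * Λ j / R
  have hsos := isSosConvex_sosModel hf hp hR hδ hc (le_max_left 1 (S / δ))
    ((Finset.sum_le_sum hS).trans (by
      have := mul_le_mul_of_nonneg_left (le_max_right 1 (S / δ)) hδ.le
      rwa [mul_div_cancel₀ _ hδ.ne'] at this))
  -- The 0 covers a set of `σ` unbounded below, where `sInf` takes its default value 0.
  have hle : sigmaBar f p c x ≤ max 0 (regPower p * (δ / 2) * max 1 (S / δ) ^ (regPower p - 2)) := by
    by_cases hb : BddBelow {σ : ℝ | IsSosConvex (sosModel f p c σ x)}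
    · exact (csInf_le hb hsos).trans (le_max_right _ _)
    · rw [sigmaBar, Real.sInf_of_not_bddBelow hb]
      exact le_max_left _ _
  refine hle.trans (max_le (le_max_of_le_left (by positivity)) ?_)
  rcases le_total (S / δ) 1 with h | h
  · rw [max_eq_left h, one_pow, mul_one]
    exact le_max_left _ _
  · rw [max_eq_right h]
    refine le_max_of_le_right (le_of_eq ?_)
    have : δ ^ (3 - (regPower p : ℝ)) = δ / δ ^ (regPower p - 2) := by
      rw [← Real.rpow_natCast, Nat.cast_sub hr, div_eq_mul_inv, ← Real.rpow_neg hδ.le, mul_comm δ,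
        ← Real.rpow_add_one hδ.ne']
      congr 1
      push_cast
      ring
    rw [this, div_pow]
    ring

end

/-! ### Taylor remainder and successful steps. -/

section

variable {n p : ℕ} {f : RSpace n → ℝ}

theorem taylorModel_eq_sum_range (x s : RSpace n) : taylorModel f p x s =
    ∑ k ∈ Finset.range (p + 1), (k ! : ℝ)⁻¹ * iteratedFDeriv ℝ k f x (fun _ => s) := by
  have hI : Finset.Icc 1 p = Finset.Ico 1 (p + 1) := by
    ext
    simp only [Finset.mem_Icc, Finset.mem_Ico]
    omega
  rw [taylorModel, hI, Finset.sum_Ico_eq_sum_range, Finset.sum_range_succ', add_comm]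
  simp only [Nat.add_sub_cancel]
  refine congrArg₂ (· + ·) (Finset.sum_congr rfl fun k _ => ?_) (by simp)
  rw [add_comm 1 k, one_div]

theorem integral_one_sub_pow (k : ℕ) : ∫ t in (0 : ℝ)..1, (1 - t) ^ k = 1 / (k + 1) := by
  rw [intervalIntegral.integral_comp_sub_left (fun t => t ^ k) 1]
  simp

/-- Integral remainder of order `p - 1`: the Lipschitz bound lets the `p`-th derivative along the
segment grow by at most `Kt`, and `∫ (1-t)^(p-1) t = 1/(p(p+1))`. -/
theorem le_taylorModel_add {L : ℝ} (hp : 1 ≤ p) (hf : IsCp1 p L f) (x s : RSpace n) :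
    f (x + s) ≤ taylorModel f p x s + L / (p * (p + 1)) * ‖s‖ ^ (p + 1) := by
  obtain ⟨m, rfl⟩ := Nat.exists_eq_add_of_le' hp
  have hfc := hf.contDiff
  have hT := map_add_eq_sum_add_integral_iteratedFDeriv (f := f) (x := x) (y := s) (n := m)
    fun t _ => by exact_mod_cast hfc.contDiffAt
  have hcont : Continuous fun t : ℝ => iteratedFDeriv ℝ (m + 1) f (x + t • s) fun _ => s := by
    have h1 := (hfc.continuous_iteratedFDeriv le_rfl).comp
      (by fun_prop : Continuous fun t : ℝ => x + t • s)
    exact (ContinuousMultilinearMap.apply ℝ (fun _ : Fin (m + 1) => RSpace n) ℝ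
      (fun _ => s)).continuous.comp h1
  set D := iteratedFDeriv ℝ (m + 1) f x fun _ => s
  set K := (m ! : ℝ) * L * ‖s‖ ^ (m + 2)
  -- The majorant is `(1-t)^m (D + Kt)` with `t` written as `1 - (1-t)`, which leaves only powers of
  -- `1 - t` to integrate.
  have hint : ∫ t in (0 : ℝ)..1, (1 - t) ^ m •
      iteratedFDeriv ℝ (m + 1) f (x + t • s) (fun _ => s) ≤
      ∫ t in (0 : ℝ)..1, ((D + K) * (1 - t) ^ m - K * (1 - t) ^ (m + 1)) := by
    refine intervalIntegral.integral_mono_on zero_le_one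
      (Continuous.intervalIntegrable (by fun_prop) _ _)
      (Continuous.intervalIntegrable (by fun_prop) _ _) fun t ht => ?_
    have h1 : iteratedFDeriv ℝ (m + 1) f (x + t • s) (fun _ => s) - D ≤ K * t := by
      have h2 := (iteratedFDeriv ℝ (m + 1) f (x + t • s) - iteratedFDeriv ℝ (m + 1) f x).le_opNorm
        fun _ => s
      have h3 := hf.lipschitz (x + t • s) x
      rw [add_sub_cancel_left, norm_smul, Real.norm_of_nonneg ht.1, Nat.add_sub_cancel] at h3
      rw [Finset.prod_const, Finset.card_univ, Fintype.card_fin] at h2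
      calc _ ≤ ‖(iteratedFDeriv ℝ (m + 1) f (x + t • s) - iteratedFDeriv ℝ (m + 1) f x) fun _ => s‖ :=
            le_abs_self _
        _ ≤ (m ! : ℝ) * L * (t * ‖s‖) * ‖s‖ ^ (m + 1) := h2.trans (by gcongr)
        _ = K * t := by simp only [K]; ring
    have h4 := mul_le_mul_of_nonneg_left h1 (pow_nonneg (sub_nonneg.2 ht.2) m)
    rw [smul_eq_mul, pow_succ]
    linarith
  have hval : ∫ t in (0 : ℝ)..1, ((D + K) * (1 - t) ^ m - K * (1 - t) ^ (m + 1)) =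
      (D + K) * (1 / (m + 1)) - K * (1 / (m + 2)) := by
    rw [intervalIntegral.integral_sub (Continuous.intervalIntegrable (by fun_prop) _ _)
      (Continuous.intervalIntegrable (by fun_prop) _ _), intervalIntegral.integral_const_mul,
      intervalIntegral.integral_const_mul, integral_one_sub_pow, integral_one_sub_pow]
    push_cast
    ring
  rw [hval] at hint
  have hm : (m ! : ℝ) ≠ 0 := by positivity
  have h5 := mul_le_mul_of_nonneg_left hint (by positivity : 0 ≤ (m ! : ℝ)⁻¹)
  rw [taylorModel_eq_sum_range, Finset.sum_range_succ, hT]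
  simp only [smul_eq_mul] at h5 ⊢
  rw [add_assoc]
  refine add_le_add_right (h5.trans_eq ?_) _
  change _ = ((m + 1)! : ℝ)⁻¹ * D + _
  rw [Nat.factorial_succ]
  simp only [K]
  push_cast
  field_simp
  ring

theorem even_regPower (p : ℕ) : Even (regPower p) := by
  unfold regPower
  split_ifs with h <;> rw [Nat.even_iff] <;> omega

theorem hasDerivAt_sosModel_smul (hp : 1 ≤ p) (c σ : ℝ) (x v : RSpace n) :
    HasDerivAt (fun t : ℝ => sosModel f p c σ x (t • v)) (fderiv ℝ f x v) 0 := by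
  have hr := two_le_regPower hp
  have hfun : (fun t : ℝ => sosModel f p c σ x (t • v)) = fun t : ℝ =>
      f x + ∑ j ∈ Finset.Icc 1 p, (1 / (j ! : ℝ) * iteratedFDeriv ℝ j f x (fun _ => v)) * t ^ j +
      (c / 2 * ‖v‖ ^ 2) * t ^ 2 + (σ / regPower p * ‖v‖ ^ regPower p) * t ^ regPower p := by
    funext t
    simp only [sosModel, taylorModel, norm_smul, mul_pow, Real.norm_eq_abs, sq_abs,
      (even_regPower p).pow_abs]
    have hsum : ∑ j ∈ Finset.Icc 1 p, 1 / (j ! : ℝ) * iteratedFDeriv ℝ j f x (fun _ => t • v) =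
        ∑ j ∈ Finset.Icc 1 p, (1 / (j ! : ℝ) * iteratedFDeriv ℝ j f x (fun _ => v)) * t ^ j := by
      refine Finset.sum_congr rfl fun j _ => ?_
      rw [ContinuousMultilinearMap.map_smul_univ (iteratedFDeriv ℝ j f x) (fun _ => t) (fun _ => v)]
      simp only [Finset.prod_const, Finset.card_univ, Fintype.card_fin, smul_eq_mul]
      ring
    rw [hsum]
    ring
  rw [hfun]
  have hsum : HasDerivAt (fun t : ℝ => ∑ j ∈ Finset.Icc 1 p,
      (1 / (j ! : ℝ) * iteratedFDeriv ℝ j f x (fun _ => v)) * t ^ j)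
      (∑ j ∈ Finset.Icc 1 p, (1 / (j ! : ℝ) * iteratedFDeriv ℝ j f x (fun _ => v)) *
        (j * 0 ^ (j - 1))) 0 :=
    HasDerivAt.fun_sum fun j _ => (hasDerivAt_pow j 0).const_mul _
  have hval : ∑ j ∈ Finset.Icc 1 p, (1 / (j ! : ℝ) * iteratedFDeriv ℝ j f x (fun _ => v)) *
      (j * 0 ^ (j - 1)) = fderiv ℝ f x v := by
    rw [Finset.sum_eq_single_of_mem 1 (Finset.mem_Icc.2 ⟨le_rfl, hp⟩)]
    · simp [iteratedFDeriv_one_apply]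
    · intro j hj hj1
      have := (Finset.mem_Icc.1 hj).1
      rw [zero_pow (by omega)]
      simp
  have h := ((hsum.const_add (f x)).add ((hasDerivAt_pow 2 (0 : ℝ)).const_mul (c / 2 * ‖v‖ ^ 2))).add
    ((hasDerivAt_pow (regPower p) (0 : ℝ)).const_mul (σ / regPower p * ‖v‖ ^ regPower p))
  rw [hval, zero_pow (by omega : regPower p - 1 ≠ 0)] at h
  exact h.congr_deriv (by simp)

/-- Excludes a zero step before termination, so that the predicted decrease is strictly positive. -/
theorem gradient_eq_zero_of_sosModel_min (hp : 1 ≤ p) {c σ : ℝ} {x : RSpace n}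
    (h : ∀ t, sosModel f p c σ x 0 ≤ sosModel f p c σ x t) : gradient f x = 0 := by
  have hd : fderiv ℝ f x = 0 := by
    ext1 v
    refine IsLocalMin.hasDerivAt_eq_zero (Filter.Eventually.of_forall fun t => ?_)
      (hasDerivAt_sosModel_smul hp c σ x v)
    simpa using h (t • v)
  simp [gradient, hd]

theorem sosModel_zero (hp : 1 ≤ p) (c σ : ℝ) (x : RSpace n) : sosModel f p c σ x 0 = f x := by
  have hr := two_le_regPower hp
  have h : ∑ j ∈ Finset.Icc 1 p,
      1 / (j ! : ℝ) * iteratedFDeriv ℝ j f x (fun _ => (0 : RSpace n)) = 0 := by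
    refine Finset.sum_eq_zero fun j hj => ?_
    rw [ContinuousMultilinearMap.map_coord_zero _ ⟨0, (Finset.mem_Icc.1 hj).1⟩ rfl, mul_zero]
  rw [sosModel, taylorModel, h]
  simp [zero_pow (by omega : regPower p ≠ 0)]

/-- If `σ ≥ A₀`, then the step is successful. -/
theorem lt_decreaseRatio (hp : 3 ≤ p) (hodd : Odd p) {L η c σ : ℝ} (hL : 0 < L)
    (hf : IsCp1 p L f) (hη : η < 1) {x s : RSpace n} (hx : gradient f x ≠ 0) (hc : 0 ≤ c)
    (hσ : 0 < σ) (hA : constA p L η ≤ σ)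
    (hs : ∀ t, sosModel f p c σ x s ≤ sosModel f p c σ x t) :
    η < decreaseRatio f p x s := by
  have hs0 : s ≠ 0 := by
    rintro rfl
    exact hx (gradient_eq_zero_of_sosModel_min (by omega) hs)
  have hreg : regPower p = p + 1 := by simp [regPower, Nat.odd_iff.1 hodd]
  have hN : 0 < ‖s‖ ^ (p + 1) := by positivity
  have hp0 : (3 : ℝ) ≤ p := by exact_mod_cast hp
  have hmin := hs 0
  rw [sosModel_zero (by omega), sosModel, hreg, Nat.cast_add_one] at hmin
  have hT := le_taylorModel_add (by omega) hf x s
  have hA' : L ≤ σ * (1 - η) := by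
    rw [constA, hreg, div_le_iff₀ (by nlinarith)] at hA
    push_cast at hA
    nlinarith
  have hcs : 0 ≤ c / 2 * ‖s‖ ^ 2 := by positivity
  have hΔ : 0 < σ / (p + 1) * ‖s‖ ^ (p + 1) := by positivity
  -- The spare factor `1/p < 1` supplies the strict inequality in `η < ρ`.
  have h1 : L / (p * (p + 1)) * ‖s‖ ^ (p + 1) < L / (p + 1) * ‖s‖ ^ (p + 1) := by
    refine mul_lt_mul_of_pos_right (div_lt_div_of_pos_left hL (by positivity) ?_) hN
    nlinarith
  have h2 : L / (p + 1) * ‖s‖ ^ (p + 1) ≤ (1 - η) * (σ / (p + 1) * ‖s‖ ^ (p + 1)) := by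
    have : (1 - η) * (σ / (p + 1) * ‖s‖ ^ (p + 1)) = σ * (1 - η) / (p + 1) * ‖s‖ ^ (p + 1) := by ring
    rw [this]
    gcongr
  have h3 : (1 - η) * (σ / (p + 1) * ‖s‖ ^ (p + 1)) ≤ (1 - η) * (f x - taylorModel f p x s) :=
    mul_le_mul_of_nonneg_left (by linarith) (by linarith)
  rw [decreaseRatio, lt_div_iff₀ (by linarith)]
  linarith

end

/-! ### Induction over the iterations. -/

theorem mainTheorem6 (n p : ℕ) (hn : 1 ≤ n) (hp : 3 ≤ p) (hodd : Odd p) :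
    (∃ R : ℝ, IsSosRadius n p R) ∧
    ∀ R : ℝ, IsSosRadius n p R →
    ∀ (f : RSpace n → ℝ) (L : ℝ), 0 < L → IsCp1 p L f →
    ∀ σmin η γ₁ γ₂ : ℝ, 0 < σmin → 0 < η → η < 1 → 1 < γ₁ → 0 < γ₂ → γ₂ < 1 →
    ∀ ε a δ : ℝ, 0 < ε → ε < 1 → 0 ≤ a → a ≤ 1 / 2 → δ = ε ^ a →
    ∀ (x s : ℕ → RSpace n) (c σr σ : ℕ → ℝ),
      IsArpSosRun f p ε δ η γ₁ γ₂ σmin x s c σr σ →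
    ∀ Λ : ℕ → ℝ,
      (∀ k, IsPerformed f ε x k → ∀ j, 1 ≤ j → j ≤ p → ‖iteratedFDeriv ℝ j f (x k)‖ ≤ Λ j) →
    ∀ σ₀ : ℝ, σ₀ = σmin ∨ σ₀ = σ 0 →
    ∀ k, IsPerformed f ε x k →
      σ k ≤ max σ₀ (max (γ₁ * constA p L η)
        (max ((regPower p : ℝ) * (δ / 2)) (constCR p Λ R * δ ^ (3 - (regPower p : ℝ))))) ∧
      σ k ≤ max σ₀ (max (γ₁ * constA p L η)
        (max ((regPower p : ℝ) * (δ / 2)) (constCR p Λ R))) * ε ^ (a * (2 - (p : ℝ))) := by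
  refine ⟨exists_isSosRadius hp hodd, ?_⟩
  intro R hR f L hL hf σmin η γ₁ γ₂ hσmin hη hη1 hγ₁ hγ₂ hγ₂1 ε a δ hε hε1 ha _ hδ x s c σr σ hrun Λ
    hΛ σ₀ hσ₀ k hk
  have hδ0 : 0 < δ := hδ ▸ Real.rpow_pos_of_pos hε a
  have hp0 : (3 : ℝ) ≤ p := by exact_mod_cast hp
  have hbar : ∀ k, IsPerformed f ε x k → sigmaBar f p (c k) (x k) ≤
      max (regPower p * (δ / 2)) (constCR p Λ R * δ ^ (3 - (regPower p : ℝ))) := fun k hk =>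
    sigmaBar_le_max hf.contDiff (by omega) hR hδ0 (hrun.perturbation k hk) (hΛ k hk)
  have hσmin_le : IsPerformed f ε x 0 → σmin ≤ σ₀ := by
    intro h0
    rcases hσ₀ with rfl | rfl
    · exact le_rfl
    · rw [hrun.σ_eq 0 h0, hrun.σr_zero]
      exact le_max_right _ _
  have h0 : IsPerformed f ε x 0 := fun j hj => hk j (by omega)
  have hσ₀min := hσmin_le h0
  set M := max σ₀ (max (γ₁ * constA p L η)
    (max ((regPower p : ℝ) * (δ / 2)) (constCR p Λ R * δ ^ (3 - (regPower p : ℝ))))) with hM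
  have hMσ₀ : σ₀ ≤ M := le_max_left _ _
  have hMA : γ₁ * constA p L η ≤ M := (le_max_left _ _).trans (le_max_right _ _)
  have hMbar : max (regPower p * (δ / 2)) (constCR p Λ R * δ ^ (3 - (regPower p : ℝ))) ≤ M :=
    (le_max_right _ _).trans (le_max_right _ _)
  -- Positivity is carried along because `lt_decreaseRatio` needs `σ k > 0`, and `γ₂ σ k ≤ σ k`
  -- needs `σ k ≥ 0`.
  have key : ∀ k, IsPerformed f ε x k → 0 < σr k ∧ σr k ≤ M := by
    intro k
    induction k with
    | zero =>
      intro _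
      rw [hrun.σr_zero]
      exact ⟨hσmin, hσ₀min.trans hMσ₀⟩
    | succ k ih =>
      intro hk1
      have hk : IsPerformed f ε x k := fun j hj => hk1 j (by omega)
      obtain ⟨hpos, hle⟩ := ih hk
      have hσk := hrun.σ_eq k hk
      have hσpos : 0 < σ k := hσk ▸ hpos.trans_le (le_max_right _ _)
      have hσM : σ k ≤ M := hσk ▸ max_le ((hbar k hk).trans hMbar) hle
      by_cases hsucc : η < decreaseRatio f p (x k) (s k)
      · rw [(hrun.success k hk hsucc).2]
        refine ⟨hσmin.trans_le (le_max_right _ _), max_le ?_ (hσ₀min.trans hMσ₀)⟩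
        exact (mul_le_of_le_one_left hσpos.le hγ₂1.le).trans hσM
      · rw [(hrun.failure k hk hsucc).2]
        refine ⟨by positivity, le_trans (mul_le_mul_of_nonneg_left ?_ (by positivity)) hMA⟩
        -- A failed step has `σ k ≤ A₀`, since otherwise it would have succeeded.
        by_contra! hlt
        refine hsucc (lt_decreaseRatio hp hodd hL hf hη1 ?_
          ((hrun.perturbation k hk).nonneg hδ0.le) hσpos hlt.le (hrun.step k hk))
        exact norm_pos_iff.1 (hε.trans (hk k le_rfl))
  have hσM : σ k ≤ M := by
    rw [hrun.σ_eq k hk]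
    exact max_le ((hbar k hk).trans hMbar) (key k hk).2
  refine ⟨hσM, hσM.trans ?_⟩
  have hδe : δ ^ (3 - (regPower p : ℝ)) = ε ^ (a * (2 - (p : ℝ))) := by
    have hreg : regPower p = p + 1 := by simp [regPower, Nat.odd_iff.1 hodd]
    rw [hδ, ← Real.rpow_mul hε.le, hreg]
    congr 1
    push_cast
    ring
  -- As `ε < 1` and `a(2 - p) ≤ 0`, this factor can be attached to every term of the maximum, not
  -- only to `C_R`.
  have hE : 1 ≤ ε ^ (a * (2 - (p : ℝ))) :=
    Real.one_le_rpow_of_pos_of_le_one_of_nonpos hε hε1.le (by nlinarith)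
  set N := max σ₀ (max (γ₁ * constA p L η) (max ((regPower p : ℝ) * (δ / 2)) (constCR p Λ R))) with hN
  have hN0 : 0 ≤ N := (hσmin.le.trans hσ₀min).trans (le_max_left _ _)
  have hNE : N ≤ N * ε ^ (a * (2 - (p : ℝ))) := le_mul_of_one_le_right hN0 hE
  rw [hM, hδe]
  refine max_le ((le_max_left _ _).trans hNE) (max_le ?_ (max_le ?_ ?_))
  · exact ((le_max_left _ _).trans (le_max_right _ _)).trans hNE
  · exact (((le_max_left _ _).trans (le_max_right _ _)).trans (le_max_right _ _)).trans hNE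
  · exact mul_le_mul_of_nonneg_right
      (((le_max_right _ _).trans (le_max_right _ _)).trans (le_max_right _ _)) (by linarith)
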